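/- Let $n\ge 1$. Points of $\mathbb R^{n+1}=\mathbb R^n\times\mathbb R$ are written $(X,t)$; diameters and distances are taken with respect to the parabolic distance $d_p((X,t),(Y,s))=|X-Y|+|t-s|^{1/2}$, and $Q_r(X,t)=\{(Y,s):|y_i-x_i|<r\ (1\le i\le n),\ |s-t|<r^2\}$. Parabolic Hausdorff measure $\mathcal H^{\eta}_{\mathrm p}$ is defined by $\mathcal H^{\eta}_{\mathrm p}(A)=\lim_{\delta\to0^+}\inf\sum_k\operatorname{diam}(A_k)^{\eta}$, the infimum being over countable coverings $(A_k)$ of $A$ by parabolic cubes with $\operatorname{diam}(A_k)\le\delta$. For a closed set $\Sigma\subset\mathbb R^{n+1}$ put $\sigma=\mathcal H^{n+1}_{\mathrm p}|_\Sigma$, $\Delta(X,t,r)=\Sigma\cap Q_r(X,t)$, $T_0=\inf\{t:(X,t)\in\Sigma\}$ and $T_1=\sup\{t:(X,t)\in\Sigma\}$ (possibly infinite). * $\Sigma$ is parabolic ADR with constant $M\ge1$ if $M^{-1}r^{n+1}\le\sigma(\Delta(X,t,r))\le M r^{n+1}$ for all $(X,t)\in\Sigma$ with $T_0<t<T_1$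 and all $0<r<\operatorname{diam}\Sigma$. * For $(Z,\tau)\in\Sigma$ and $r>0$ let $\beta(Z,\tau,r)=\inf_P\big(r^{-n-1}\iint_{\Delta(Z,\tau,r)}(d_p(Y,s,P)/r)^2\,d\sigma(Y,s)\big)^{1/2}$, the infimum being over all $n$-dimensional planes $P$ containing a line parallel to the $t$-axis, and let $d\nu(Z,\tau,r)=\beta^2(Z,\tau,r)\,d\sigma(Z,\tau)\,r^{-1}dr$ on $\Sigma\times(0,\infty)$. $\Sigma$ is parabolic uniformly rectifiable (UR) with constants $(M,\tilde M)$ if it is parabolic ADR with constant $M$ and $\nu(\Delta(X,t,\rho)\times(0,\rho))\le\tilde M\rho^{n+1}$ for all $(X,t)\in\Sigma$ and $\rho>0$. * $\Sigma$ satisfies the (two-sided) corkscrew condition with constant $\gamma_0\in(0,1)$ if for all $(X,t)\in\Sigma$ with $T_0<t<T_1$ and all $0<r<\operatorname{diam}\Sigma$ there are $\rho$ with $\gamma_0r\le\rho<r$ and cubes $Q_\rho(X_1,t_1),Q_\rho(X_2,t_2)\subset Q_r(X,t)$ such that the sets $Q_\rho(X_1,t_1)\cap(\mathbb R^n\times(T_0,T_1))$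 and $Q_\rho(X_2,t_2)\cap(\mathbb R^n\times(T_0,T_1))$ are nonempty and contained in different connected components of $\mathbb R^{n+1}\setminus\Sigma$. * $\Sigma$ satisfies the weak time-synchronized two-cube condition with constant $\gamma_1\in(0,1)$ if the previous condition holds with $\gamma_1$ in place of $\gamma_0$ and the two cubes can in addition always be chosen with $t_1=t_2$. **Theorem.** For all $n\ge1$, $M\ge1$, $\gamma_0\in(0,1)$ and $\tilde M\ge0$ there is $\gamma_1=\gamma_1(n,M,\gamma_0,\tilde M)\in(0,1)$ such that the following holds. If $\Sigma\subset\mathbb R^{n+1}$ is a closed set which is parabolic ADR with constant $M$, satisfies the corkscrew condition with constant $\gamma_0$, and is parabolic UR with constants $(M,\tilde M)$, then $\Sigma$ satisfies the weak time-synchronized two-cube condition with constant $\gamma_1$. -/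

import Mathlib

open Set MeasureTheory Metric
open scoped ENNReal

noncomputable section

/-- Space-time `ℝⁿ⁺¹ = ℝⁿ × ℝ`, with points `(X, t)`. It carries the usual topology, Borel
σ-algebra and linear structure, and below it is metrized by the parabolic distance. -/
def SpaceTime (n : ℕ) : Type := EuclideanSpace ℝ (Fin n) × ℝ

namespace SpaceTime

variable {n : ℕ}

/-- The point `(X, t)`. -/
def mk (X : EuclideanSpace ℝ (Fin n)) (t : ℝ) : SpaceTime n := Prod.mk X t

/-- The spatial part `X` of `(X, t)`. -/
def space (p : SpaceTime n) : EuclideanSpace ℝ (Fin n) := Prod.fst p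

/-- The time coordinate `t` of `(X, t)`. -/
def time (p : SpaceTime n) : ℝ := Prod.snd p

instance : AddCommGroup (SpaceTime n) := inferInstanceAs (AddCommGroup (EuclideanSpace ℝ (Fin n) × ℝ))

instance : Module ℝ (SpaceTime n) := inferInstanceAs (Module ℝ (EuclideanSpace ℝ (Fin n) × ℝ))

instance : TopologicalSpace (SpaceTime n) :=
  inferInstanceAs (TopologicalSpace (EuclideanSpace ℝ (Fin n) × ℝ))

instance : MeasurableSpace (SpaceTime n) :=
  inferInstanceAs (MeasurableSpace (EuclideanSpace ℝ (Fin n) × ℝ))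

instance : BorelSpace (SpaceTime n) :=
  inferInstanceAs (BorelSpace (EuclideanSpace ℝ (Fin n) × ℝ))

/-- The parabolic distance `d_p((X,t),(Y,s)) = |X - Y| + |t - s|^{1/2}`. -/
def parabolicDist (p q : SpaceTime n) : ℝ :=
  ‖p.space - q.space‖ + √|p.time - q.time|

theorem parabolicDist_self (p : SpaceTime n) : parabolicDist p p = 0 := by
  simp [parabolicDist]

theorem parabolicDist_comm (p q : SpaceTime n) : parabolicDist p q = parabolicDist q p := by
  simp [parabolicDist, norm_sub_rev p.space q.space, abs_sub_comm p.time q.time]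

theorem parabolicDist_triangle (p q w : SpaceTime n) :
    parabolicDist p w ≤ parabolicDist p q + parabolicDist q w := by
  have h1 := norm_sub_le_norm_sub_add_norm_sub p.space q.space w.space
  have h2 : √|p.time - w.time| ≤ √|p.time - q.time| + √|q.time - w.time| := by
    refine Real.sqrt_le_iff.2 ⟨by positivity, ?_⟩
    have ha := Real.sq_sqrt (abs_nonneg (p.time - q.time))
    have hb := Real.sq_sqrt (abs_nonneg (q.time - w.time))
    have hc := abs_sub_le p.time q.time w.time
    have hd := mul_nonneg (Real.sqrt_nonneg |p.time - q.time|) (Real.sqrt_nonneg |q.time - w.time|)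
    nlinarith
  unfold parabolicDist
  linarith

theorem eq_of_parabolicDist_eq_zero (p q : SpaceTime n) (h : parabolicDist p q = 0) : p = q := by
  have h1 := norm_nonneg (p.space - q.space)
  have h2 := Real.sqrt_nonneg |p.time - q.time|
  unfold parabolicDist at h
  have h3 : ‖p.space - q.space‖ = 0 := by linarith
  have h4 : √|p.time - q.time| = 0 := by linarith
  rw [Real.sqrt_eq_zero (abs_nonneg _), abs_eq_zero, sub_eq_zero] at h4
  rw [norm_eq_zero, sub_eq_zero] at h3
  exact Prod.ext h3 h4

/-- The parabolic distance induces the usual topology of `ℝⁿ⁺¹`. -/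
theorem isOpen_iff_parabolicDist (s : Set (SpaceTime n)) :
    IsOpen s ↔ ∀ x ∈ s, ∃ ε > 0, ∀ y, parabolicDist x y < ε → y ∈ s := by
  have key : IsOpen s ↔ ∀ x ∈ s, ∃ ε > 0, ∀ y : SpaceTime n,
      ‖y.space - x.space‖ < ε → |y.time - x.time| < ε → y ∈ s := by
    have e (ε : ℝ) (x y : EuclideanSpace ℝ (Fin n) × ℝ) :
        y ∈ Metric.ball x ε ↔ ‖y.1 - x.1‖ < ε ∧ |y.2 - x.2| < ε := by
      rw [Metric.mem_ball, Prod.dist_eq, max_lt_iff, dist_eq_norm, Real.dist_eq]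
    refine (Metric.isOpen_iff (α := EuclideanSpace ℝ (Fin n) × ℝ) (s := s)).trans ?_
    refine forall₂_congr fun x _ => exists_congr fun ε => and_congr_right fun _ => ?_
    exact ⟨fun h y h1 h2 => h ((e ε x y).2 ⟨h1, h2⟩),
      fun h y hy => h y ((e ε x y).1 hy).1 ((e ε x y).1 hy).2⟩
  rw [key]
  refine forall₂_congr fun x _ => ?_
  constructor
  · rintro ⟨ε, hε, h⟩
    refine ⟨min ε (√ε), lt_min hε (Real.sqrt_pos.2 hε), fun y hy => h y ?_ ?_⟩
    · rw [norm_sub_rev]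
      exact (le_add_of_nonneg_right (Real.sqrt_nonneg _)).trans_lt (hy.trans_le (min_le_left _ _))
    · rw [abs_sub_comm]
      refine (Real.sqrt_lt_sqrt_iff (abs_nonneg _)).1 ?_
      exact (le_add_of_nonneg_left (norm_nonneg _)).trans_lt (hy.trans_le (min_le_right _ _))
  · rintro ⟨ε, hε, h⟩
    refine ⟨min (ε / 2) ((ε / 2) ^ 2), lt_min (by positivity) (by positivity),
      fun y h1 h2 => h y ?_⟩
    rw [norm_sub_rev] at h1
    rw [abs_sub_comm] at h2
    have h3 : √|x.time - y.time| < ε / 2 :=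
      (Real.sqrt_lt' (by positivity)).2 (h2.trans_le (min_le_right _ _))
    have h4 := h1.trans_le (min_le_left _ _)
    unfold parabolicDist
    linarith

/-- The distance on space-time is the parabolic one; the topology is the usual one. -/
instance : MetricSpace (SpaceTime n) :=
  MetricSpace.ofDistTopology parabolicDist parabolicDist_self parabolicDist_comm
    parabolicDist_triangle isOpen_iff_parabolicDist eq_of_parabolicDist_eq_zero

theorem dist_def (p q : SpaceTime n) : dist p q = ‖p.space - q.space‖ + √|p.time - q.time| := rfl

end SpaceTime

/-- The open parabolic cube `Q_r(X,t) = {(Y,s) : |y_i - x_i| < r, |s - t| < r²}`. -/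
def parabolicCube {n : ℕ} (p : SpaceTime n) (r : ℝ) : Set (SpaceTime n) :=
  {q | (∀ i, |q.space i - p.space i| < r) ∧ |q.time - p.time| < r ^ 2}

/-- Parabolic Hausdorff measure of homogeneous dimension `η`: the limit as `δ → 0` of the infimum
of `∑ diam_p(A_k)^η` over countable coverings by parabolic cubes `A_k` of parabolic diameter at
most `δ`. Sets that are not parabolic cubes have weight `⊤`, so they never help in a covering. -/
def parabolicHausdorff (n : ℕ) (η : ℝ) : Measure (SpaceTime n) :=
  Measure.mkMetric' fun A =>
    ⨅ _ : ∃ (p : SpaceTime n) (r : ℝ), 0 < r ∧ A = parabolicCube p r, ediam A ^ η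

section Sets

variable {n : ℕ} (S : Set (SpaceTime n))

/-- Surface measure on `S`: the restriction to `S` of parabolic Hausdorff measure of homogeneous
dimension `n + 1`. -/
def surfaceMeasure : Measure (SpaceTime n) :=
  (parabolicHausdorff n (n + 1)).restrict S

/-- The surface cube `Δ(X,t,r) = S ∩ Q_r(X,t)`. -/
def surfaceCube (p : SpaceTime n) (r : ℝ) : Set (SpaceTime n) := S ∩ parabolicCube p r

/-- The extremal time `T₀ = inf {t : (X,t) ∈ S}`, possibly `-∞`. -/
def minTime : EReal := ⨅ p ∈ S, (p.time : EReal)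

/-- The extremal time `T₁ = sup {t : (X,t) ∈ S}`, possibly `+∞`. -/
def maxTime : EReal := ⨆ p ∈ S, (p.time : EReal)

/-- The open slab `ℝⁿ × (T₀, T₁)`. -/
def timeSlab : Set (SpaceTime n) := {p | minTime S < p.time ∧ (p.time : EReal) < maxTime S}

/-- Parabolic Ahlfors–David regularity of the closed set `S`, with constant `M`. -/
def IsParabolicADR (M : ℝ) : Prop :=
  IsClosed S ∧ ∀ p ∈ S, p ∈ timeSlab S → ∀ r : ℝ, 0 < r → ENNReal.ofReal r < ediam S →
    ENNReal.ofReal (M⁻¹ * r ^ (n + 1)) ≤ surfaceMeasure S (surfaceCube S p r) ∧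
    surfaceMeasure S (surfaceCube S p r) ≤ ENNReal.ofReal (M * r ^ (n + 1))

/-- `P` is an `n`-dimensional plane of `ℝⁿ⁺¹` containing a line parallel to the `t`-axis. -/
def IsTimePlane (P : AffineSubspace ℝ (SpaceTime n)) : Prop :=
  Module.finrank ℝ P.direction = n ∧
    ∃ X : EuclideanSpace ℝ (Fin n), ∀ t : ℝ, SpaceTime.mk X t ∈ P

/-- `β(Z,τ,r) = inf_P (r^{-n-1} ∬_{Δ(Z,τ,r)} (d_p(Y,s,P)/r)² dσ(Y,s))^{1/2}`, the infimum being over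
the `n`-dimensional planes `P` that contain a line parallel to the `t`-axis. -/
def betaNumber (p : SpaceTime n) (r : ℝ) : ℝ≥0∞ :=
  ⨅ (P : AffineSubspace ℝ (SpaceTime n)) (_ : IsTimePlane P),
    ((ENNReal.ofReal (r ^ (n + 1)))⁻¹ *
      ∫⁻ q in surfaceCube S p r, (infEDist q (P : Set (SpaceTime n)) / ENNReal.ofReal r) ^ 2
        ∂(surfaceMeasure S)) ^ (1 / 2 : ℝ)

/-- The measure `dν(Z,τ,r) = β(Z,τ,r)² dσ(Z,τ) r⁻¹ dr` on `S × (0,∞)`. -/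
def betaMeasure : Measure (SpaceTime n × ℝ) :=
  ((surfaceMeasure S).prod (volume.restrict (Ioi (0 : ℝ)))).withDensity fun z =>
    betaNumber S z.1 z.2 ^ 2 * (ENNReal.ofReal z.2)⁻¹

/-- Parabolic uniform rectifiability with constants `(M, M')`: `S` is parabolic ADR with constant
`M` and `ν(Δ(X,t,ρ) × (0,ρ)) ≤ M' ρ^{n+1}` for all `(X,t) ∈ S` and all `ρ > 0`. -/
def IsParabolicUR (M M' : ℝ) : Prop :=
  IsParabolicADR S M ∧ ∀ p ∈ S, ∀ ρ : ℝ, 0 < ρ →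
    betaMeasure S (surfaceCube S p ρ ×ˢ Ioo 0 ρ) ≤ ENNReal.ofReal (M' * ρ ^ (n + 1))

/-- `A` and `B` are (nonempty and) contained in different connected components of the complement
of `S`. -/
def InDifferentComponents (A B : Set (SpaceTime n)) : Prop :=
  A.Nonempty ∧ B.Nonempty ∧ ∃ a ∈ Sᶜ, ∃ b ∈ Sᶜ,
    connectedComponentIn Sᶜ a ≠ connectedComponentIn Sᶜ b ∧
    A ⊆ connectedComponentIn Sᶜ a ∧ B ⊆ connectedComponentIn Sᶜ b

/-- The (two-sided) corkscrew condition, or two-cube condition, with constant `γ`. -/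
def CorkscrewCondition (γ : ℝ) : Prop :=
  ∀ p ∈ S, p ∈ timeSlab S → ∀ r : ℝ, 0 < r → ENNReal.ofReal r < ediam S →
    ∃ (p₁ p₂ : SpaceTime n) (ρ : ℝ), γ * r ≤ ρ ∧ ρ < r ∧
      parabolicCube p₁ ρ ⊆ parabolicCube p r ∧ parabolicCube p₂ ρ ⊆ parabolicCube p r ∧
      InDifferentComponents S (parabolicCube p₁ ρ ∩ timeSlab S) (parabolicCube p₂ ρ ∩ timeSlab S)

/-- The weak time-synchronized two-cube condition with constant `γ`: as in the corkscrew condition,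
but the centers of the two cubes have the same time coordinate. -/
def WeakSynchronizedTwoCubeCondition (γ : ℝ) : Prop :=
  ∀ p ∈ S, p ∈ timeSlab S → ∀ r : ℝ, 0 < r → ENNReal.ofReal r < ediam S →
    ∃ (p₁ p₂ : SpaceTime n) (ρ : ℝ), γ * r ≤ ρ ∧ ρ < r ∧
      parabolicCube p₁ ρ ⊆ parabolicCube p r ∧ parabolicCube p₂ ρ ⊆ parabolicCube p r ∧
      InDifferentComponents S (parabolicCube p₁ ρ ∩ timeSlab S)
        (parabolicCube p₂ ρ ∩ timeSlab S) ∧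
      p₁.time = p₂.time

end Sets

end

/-! The Carleson packing condition cannot have β bounded below at all points and scales near a
surface cube: integrating ds/s over a long range of scales would give too much mass. So some surface
cube of comparable size has small β (`exists_betaNumber_sq_lt`), and lower ADR upgrades this L²
flatness to uniform closeness to a hyperplane containing the time direction
(`IsParabolicADR.exists_abs_inner_lt`).

Away from that hyperplane, each side of the cube within the time slab is convex and misses Σ. Each
corkscrew cube reaches well into one side, so that side lies in the component of the cube. As the
hyperplane is vertical, smaller cubes can be recentred at one common time without leaving their
sides (`exists_synchronized_of_flat`).

ADR and corkscrews are available only at times strictly between T₀ and T₁. The extremal slices are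
discarded because they are σ-null. -/

namespace SpaceTime

variable {n : ℕ}

@[simp] theorem mk_space (X : EuclideanSpace ℝ (Fin n)) (t : ℝ) : (mk X t).space = X := rfl
@[simp] theorem mk_time (X : EuclideanSpace ℝ (Fin n)) (t : ℝ) : (mk X t).time = t := rfl
@[simp] theorem add_space (p q : SpaceTime n) : (p + q).space = p.space + q.space := rfl
@[simp] theorem add_time (p q : SpaceTime n) : (p + q).time = p.time + q.time := rfl
@[simp] theorem smul_space (c : ℝ) (p : SpaceTime n) : (c • p).space = c • p.space := rfl
@[simp] theorem smul_time (c : ℝ) (p : SpaceTime n) : (c • p).time = c * p.time := rfl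

instance : IsTopologicalAddGroup (SpaceTime n) :=
  inferInstanceAs (IsTopologicalAddGroup (EuclideanSpace ℝ (Fin n) × ℝ))

instance : ContinuousSMul ℝ (SpaceTime n) :=
  inferInstanceAs (ContinuousSMul ℝ (EuclideanSpace ℝ (Fin n) × ℝ))

theorem continuous_space : Continuous (space : SpaceTime n → EuclideanSpace ℝ (Fin n)) :=
  continuous_fst (X := EuclideanSpace ℝ (Fin n)) (Y := ℝ)

theorem continuous_time : Continuous (time : SpaceTime n → ℝ) :=
  continuous_snd (X := EuclideanSpace ℝ (Fin n)) (Y := ℝ)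

end SpaceTime

section

open SpaceTime

variable {n : ℕ}

/-! ### Geometry of parabolic cubes. -/

theorem EuclideanSpace.norm_le_card_mul (v : EuclideanSpace ℝ (Fin n)) {ρ : ℝ} (hρ : 0 ≤ ρ)
    (h : ∀ i, |v i| ≤ ρ) : ‖v‖ ≤ n * ρ := by
  rw [EuclideanSpace.norm_eq]
  refine Real.sqrt_le_iff.2 ⟨by positivity, ?_⟩
  have h1 : ∑ i, ‖v i‖ ^ 2 ≤ ∑ _i : Fin n, ρ ^ 2 := by
    refine Finset.sum_le_sum fun i _ => ?_
    rw [Real.norm_eq_abs]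
    exact pow_le_pow_left₀ (abs_nonneg _) (h i) 2
  refine h1.trans ?_
  simp only [Finset.sum_const, Finset.card_univ, Fintype.card_fin, nsmul_eq_mul]
  rw [mul_pow]
  refine mul_le_mul_of_nonneg_right ?_ (sq_nonneg ρ)
  rcases Nat.eq_zero_or_pos n with rfl | hn
  · simp
  · have : (1 : ℝ) ≤ n := by exact_mod_cast hn
    nlinarith

theorem EuclideanSpace.abs_apply_le_norm (v : EuclideanSpace ℝ (Fin n)) (i : Fin n) :
    |v i| ≤ ‖v‖ := by
  rw [← Real.norm_eq_abs]
  exact PiLp.norm_apply_le v i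

theorem mem_parabolicCube_self (p : SpaceTime n) {r : ℝ} (hr : 0 < r) : p ∈ parabolicCube p r := by
  simp [parabolicCube, hr]

theorem isOpen_parabolicCube (p : SpaceTime n) (r : ℝ) : IsOpen (parabolicCube p r) := by
  have h1 : parabolicCube p r = (⋂ i, {q | |q.space i - p.space i| < r}) ∩
      {q | |q.time - p.time| < r ^ 2} := by
    ext q; simp [parabolicCube]
  rw [h1]
  have hc (i : Fin n) : Continuous fun q : SpaceTime n => q.space i :=
    (EuclideanSpace.proj i : EuclideanSpace ℝ (Fin n) →L[ℝ] ℝ).continuous.comp continuous_space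
  refine (isOpen_iInter_of_finite fun i => ?_).inter ?_
  · exact isOpen_lt ((hc i).sub continuous_const).abs continuous_const
  · exact isOpen_lt (continuous_time.sub continuous_const).abs continuous_const

theorem convex_parabolicCube (p : SpaceTime n) (r : ℝ) : Convex ℝ (parabolicCube p r) := by
  intro x hx y hy a b ha hb hab
  have key (u v c R : ℝ) (hu : |u - c| < R) (hv : |v - c| < R) : |a * u + b * v - c| < R := by
    rw [abs_lt] at *
    have := Convex.min_le_combo (u - c) (v - c) ha hb hab
    have := Convex.combo_le_max (u - c) (v - c) ha hb hab
    simp only [smul_eq_mul] at *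
    have e : a * u + b * v - c = a * (u - c) + b * (v - c) := by
      linear_combination (c : ℝ) * hab
    rw [e]
    exact ⟨(lt_min hu.1 hv.1).trans_le (by assumption),
      lt_of_le_of_lt (by assumption) (max_lt hu.2 hv.2)⟩
  refine ⟨fun i => ?_, ?_⟩
  · simpa using key _ _ _ _ (hx.1 i) (hy.1 i)
  · simpa using key _ _ _ _ hx.2 hy.2

theorem parabolicCube_subset_parabolicCube {p q : SpaceTime n} {r s R : ℝ}
    (hq : q ∈ parabolicCube p r) (hr : 0 ≤ r) (hs : 0 ≤ s) (h : r + s ≤ R) :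
    parabolicCube q s ⊆ parabolicCube p R := by
  intro z hz
  refine ⟨fun i => ?_, ?_⟩
  · have := abs_sub_le (z.space i) (q.space i) (p.space i)
    have := hz.1 i
    have := hq.1 i
    linarith
  · have := abs_sub_le z.time q.time p.time
    have := hz.2
    have := hq.2
    nlinarith [mul_nonneg hr hs]

theorem dist_le_of_mem_parabolicCube {p q : SpaceTime n} {r : ℝ} (hr : 0 ≤ r)
    (h : q ∈ parabolicCube p r) : dist q p ≤ (n + 1) * r := by
  rw [SpaceTime.dist_def]
  have h1 := EuclideanSpace.norm_le_card_mul (q.space - p.space) hr fun i => by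
    simpa using (h.1 i).le
  have h2 : √|q.time - p.time| ≤ r := Real.sqrt_le_iff.2 ⟨hr, h.2.le⟩
  linarith

theorem ediam_parabolicCube_le (p : SpaceTime n) {r : ℝ} (hr : 0 ≤ r) :
    ediam (parabolicCube p r) ≤ ENNReal.ofReal (2 * (n + 1) * r) := by
  refine ediam_le fun x hx y hy => ?_
  rw [edist_dist]
  refine ENNReal.ofReal_le_ofReal ?_
  have := dist_triangle_right x y p
  have := dist_le_of_mem_parabolicCube hr hx
  have := dist_le_of_mem_parabolicCube hr hy
  linarith

/-! ### Nullity of time slices. -/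

theorem unitSlice_subset_iUnion_parabolicCube (v : Fin n → ℤ) (t : ℝ) {N : ℕ} (hN : 0 < N) :
    {q : SpaceTime n | q.time = t ∧ ∀ i, (v i : ℝ) ≤ q.space i ∧ q.space i < v i + 1} ⊆
      ⋃ k : Fin n → Fin N,
        parabolicCube (SpaceTime.mk (WithLp.toLp 2 fun i => (v i : ℝ) + (k i : ℕ) / N) t)
          (1 / N) := by
  rintro q ⟨hq, hv⟩
  have hN' : (0 : ℝ) < N := by exact_mod_cast hN
  have hlt (i : Fin n) : ⌊(q.space i - v i) * N⌋₊ < N := by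
    refine (Nat.floor_lt (mul_nonneg (by linarith [hv i]) hN'.le)).2 ?_
    nlinarith [(hv i).2]
  refine mem_iUnion.2 ⟨fun i => ⟨⌊(q.space i - v i) * N⌋₊, hlt i⟩, fun i => ?_, ?_⟩
  · have h0 : 0 ≤ (q.space i - v i) * N := mul_nonneg (by linarith [hv i]) hN'.le
    have h1 := Nat.floor_le h0
    have h2 := Nat.lt_floor_add_one ((q.space i - v i) * N)
    have e : q.space i - (v i + (⌊(q.space i - v i) * N⌋₊ : ℝ) / N) =
        ((q.space i - v i) * N - ⌊(q.space i - v i) * N⌋₊) / N := by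
      field_simp
      ring
    simp only [mk_space]
    rw [e, abs_of_nonneg (div_nonneg (by linarith) hN'.le)]
    exact div_lt_div_of_pos_right (by linarith) hN'
  · simp only [mk_time, hq, sub_self, abs_zero]
    positivity

/-- A slice has parabolic dimension n: it is covered by N^n cubes of diameter at most C/N, whose
total (n+1)-weight is at most C^(n+1)/N. -/
theorem parabolicHausdorff_unitSlice (v : Fin n → ℤ) (t : ℝ) :
    parabolicHausdorff n (n + 1)
      {q : SpaceTime n | q.time = t ∧ ∀ i, (v i : ℝ) ≤ q.space i ∧ q.space i < v i + 1} = 0 := by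
  set A := {q : SpaceTime n | q.time = t ∧ ∀ i, (v i : ℝ) ≤ q.space i ∧ q.space i < v i + 1}
  have hc (i : Fin n) : Continuous fun q : SpaceTime n => q.space i :=
    (EuclideanSpace.proj i : EuclideanSpace ℝ (Fin n) →L[ℝ] ℝ).continuous.comp continuous_space
  have hA : MeasurableSet A := by
    have e : A = {q | q.time = t} ∩
        ⋂ i, ({q | (v i : ℝ) ≤ q.space i} ∩ {q | q.space i < (v i : ℝ) + 1}) := by
      ext q; simp [A]
    rw [e]
    refine (measurableSet_eq_fun continuous_time.measurable measurable_const).inter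
      (MeasurableSet.iInter fun i => ?_)
    exact (measurableSet_le measurable_const (hc i).measurable).inter
      (measurableSet_lt (hc i).measurable measurable_const)
  rw [parabolicHausdorff, Measure.mkMetric', toMeasure_apply _ _ hA, OuterMeasure.mkMetric']
  set m : Set (SpaceTime n) → ℝ≥0∞ := fun A =>
    ⨅ _ : ∃ (p : SpaceTime n) (r : ℝ), 0 < r ∧ A = parabolicCube p r,
      ediam A ^ ((n : ℝ) + 1) with hm
  simp only [OuterMeasure.iSup_apply, ENNReal.iSup_eq_zero]
  intro δ hδ
  set C : ℝ := 2 * (n + 1)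
  have hC : 0 < C := by positivity
  have hev1 : ∀ᶠ N : ℕ in Filter.atTop, ENNReal.ofReal (C * (1 / N)) ≤ δ := by
    have h1 : Filter.Tendsto (fun N : ℕ => ENNReal.ofReal (C * (1 / N))) Filter.atTop
        (nhds (ENNReal.ofReal (C * 0))) :=
      ENNReal.tendsto_ofReal (tendsto_one_div_atTop_nhds_zero_nat.const_mul C)
    rw [mul_zero, ENNReal.ofReal_zero] at h1
    exact (h1.eventually_lt_const hδ).mono fun _ h => h.le
  have hbound : ∀ᶠ N : ℕ in Filter.atTop, OuterMeasure.mkMetric'.pre m δ A ≤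
      ENNReal.ofReal (C ^ (n + 1) * (1 / N)) := by
    filter_upwards [hev1, Filter.eventually_gt_atTop 0] with N hNδ hN
    have hN' : (0 : ℝ) < N := by exact_mod_cast hN
    refine (measure_mono (unitSlice_subset_iUnion_parabolicCube v t hN)).trans ?_
    refine (measure_iUnion_fintype_le _ _).trans ?_
    have hk (k : Fin n → Fin N) : OuterMeasure.mkMetric'.pre m δ
        (parabolicCube (SpaceTime.mk (WithLp.toLp 2 fun i => (v i : ℝ) + (k i : ℕ) / N) t)
          (1 / N)) ≤ ENNReal.ofReal ((C * (1 / N)) ^ (n + 1)) := by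
      have hd := ediam_parabolicCube_le
        (SpaceTime.mk (WithLp.toLp 2 fun i => (v i : ℝ) + (k i : ℕ) / N) t)
        (show (0 : ℝ) ≤ 1 / N by positivity)
      refine (OuterMeasure.mkMetric'.pre_le (hd.trans hNδ)).trans ?_
      refine (iInf_le _ ⟨_, _, by positivity, rfl⟩).trans ?_
      refine (ENNReal.rpow_le_rpow hd (by positivity)).trans ?_
      rw [ENNReal.ofReal_pow (by positivity), ← ENNReal.rpow_natCast]
      push_cast
      exact le_rfl
    refine (Finset.sum_le_sum fun k _ => hk k).trans ?_
    rw [Finset.sum_const, nsmul_eq_mul, Finset.card_univ, Fintype.card_fun, Fintype.card_fin,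
      Fintype.card_fin, ← ENNReal.ofReal_natCast, ← ENNReal.ofReal_mul (by positivity)]
    refine ENNReal.ofReal_le_ofReal (le_of_eq ?_)
    push_cast
    rw [mul_pow, one_div, inv_pow, pow_succ (N : ℝ) n]
    field_simp
  have hlim : Filter.Tendsto (fun N : ℕ => ENNReal.ofReal (C ^ (n + 1) * (1 / N))) Filter.atTop
      (nhds (ENNReal.ofReal (C ^ (n + 1) * 0))) :=
    ENNReal.tendsto_ofReal (tendsto_one_div_atTop_nhds_zero_nat.const_mul _)
  rw [mul_zero, ENNReal.ofReal_zero] at hlim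
  exact le_antisymm (ge_of_tendsto hlim hbound) bot_le

/-- Time slices are null for parabolic Hausdorff measure of dimension `n + 1`. -/
theorem parabolicHausdorff_timeSlice (t : ℝ) :
    parabolicHausdorff n (n + 1) {q : SpaceTime n | q.time = t} = 0 := by
  have h : {q : SpaceTime n | q.time = t} ⊆ ⋃ v : Fin n → ℤ,
      {q : SpaceTime n | q.time = t ∧ ∀ i, (v i : ℝ) ≤ q.space i ∧ q.space i < v i + 1} :=
    fun q hq => mem_iUnion.2 ⟨fun i => ⌊q.space i⌋, hq, fun i =>
      ⟨Int.floor_le _, Int.lt_floor_add_one _⟩⟩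
  exact measure_mono_null h (measure_iUnion_null fun v => parabolicHausdorff_unitSlice v t)

theorem isOpen_timeSlab (S : Set (SpaceTime n)) : IsOpen (timeSlab S) := by
  have hc : Continuous fun p : SpaceTime n => (p.time : EReal) :=
    continuous_coe_real_ereal.comp continuous_time
  exact (isOpen_lt continuous_const hc).inter (isOpen_lt hc continuous_const)

theorem convex_timeSlab (S : Set (SpaceTime n)) : Convex ℝ (timeSlab S) := by
  intro x hx y hy a b ha hb hab
  have h1 := Convex.min_le_combo x.time y.time ha hb hab
  have h2 := Convex.combo_le_max x.time y.time ha hb hab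
  simp only [smul_eq_mul] at h1 h2
  refine ⟨?_, ?_⟩
  · refine lt_of_lt_of_le ?_ (EReal.coe_le_coe_iff.2 h1)
    rcases min_choice x.time y.time with h | h <;> rw [h]
    exacts [hx.1, hy.1]
  · refine lt_of_le_of_lt (EReal.coe_le_coe_iff.2 h2) ?_
    rcases max_choice x.time y.time with h | h <;> rw [h]
    exacts [hx.2, hy.2]

theorem mem_timeSlab_of_time_eq {S : Set (SpaceTime n)} {p q : SpaceTime n} (hp : p ∈ timeSlab S)
    (h : q.time = p.time) : q ∈ timeSlab S := by
  unfold timeSlab at *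
  simpa [h] using hp

theorem surfaceMeasure_diff_timeSlab (S : Set (SpaceTime n)) :
    surfaceMeasure S (S \ timeSlab S) = 0 := by
  -- An infinite extremal time has `toReal` equal to 0; this only adds a harmless null slice.
  have h : S \ timeSlab S ⊆ {q | q.time = (minTime S).toReal} ∪ {q | q.time = (maxTime S).toReal} := by
    rintro q ⟨hqS, hq⟩
    have h1 : minTime S ≤ q.time := iInf₂_le q hqS
    have h2 : (q.time : EReal) ≤ maxTime S :=
      le_iSup₂ (f := fun (p : SpaceTime n) _ => (p.time : EReal)) q hqS
    rcases h1.lt_or_eq with h1 | h1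
    · rcases h2.lt_or_eq with h2 | h2
      · exact absurd ⟨h1, h2⟩ hq
      · right
        simp [← h2]
    · left
      simp [h1]
  refine measure_mono_null h ?_
  refine measure_union_null ?_ ?_ <;>
  exact Measure.restrict_le_self.absolutelyContinuous (parabolicHausdorff_timeSlice _)

theorem surfaceMeasure_inter_timeSlab (S A : Set (SpaceTime n)) (hA : A ⊆ S) :
    surfaceMeasure S (A ∩ timeSlab S) = surfaceMeasure S A := by
  refine le_antisymm (measure_mono inter_subset_left) ?_
  have h : A ⊆ (A ∩ timeSlab S) ∪ (S \ timeSlab S) := fun q hq => by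
    by_cases hs : q ∈ timeSlab S
    · exact Or.inl ⟨hq, hs⟩
    · exact Or.inr ⟨hA hq, hs⟩
  refine (measure_mono h).trans ((measure_union_le _ _).trans ?_)
  rw [surfaceMeasure_diff_timeSlab, add_zero]

/-! ### Carleson packing and a scale with small β. -/

/-- A lower bound for the density of `ν` on a rectangle. -/
theorem mul_log_le_betaMeasure (S A : Set (SpaceTime n)) (hA : MeasurableSet A) {a ρ κ : ℝ}
    (ha : 0 < a) (ha1 : a < 1) (hρ : 0 < ρ)
    (h : ∀ q ∈ A, ∀ s ∈ Ioo (a * ρ) ρ, ENNReal.ofReal κ ≤ betaNumber S q s ^ 2) :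
    surfaceMeasure S A * (ENNReal.ofReal κ * ENNReal.ofReal (Real.log a⁻¹)) ≤
      betaMeasure S (A ×ˢ Ioo 0 ρ) := by
  have haρ : 0 < a * ρ := mul_pos ha hρ
  have hsub : A ×ˢ Ioo (a * ρ) ρ ⊆ A ×ˢ Ioo 0 ρ :=
    prod_mono le_rfl (Ioo_subset_Ioo_left haρ.le)
  refine le_trans ?_ (measure_mono hsub)
  rw [betaMeasure, withDensity_apply _ (hA.prod measurableSet_Ioo)]
  have hm : Measurable fun s : ℝ => ENNReal.ofReal κ * (ENNReal.ofReal s)⁻¹ := by fun_prop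
  have hlog : ∫⁻ s in Ioo (a * ρ) ρ, (ENNReal.ofReal s)⁻¹ = ENNReal.ofReal (Real.log a⁻¹) := by
    have h1 : ∫⁻ s in Ioo (a * ρ) ρ, (ENNReal.ofReal s)⁻¹ =
        ∫⁻ s in Ioc (a * ρ) ρ, ENNReal.ofReal s⁻¹ := by
      rw [setLIntegral_congr Ioo_ae_eq_Ioc]
      refine setLIntegral_congr_fun measurableSet_Ioc fun s hs => ?_
      exact (ENNReal.ofReal_inv_of_pos (haρ.trans hs.1)).symm
    have hle : a * ρ ≤ ρ := by nlinarith
    have hnot : (0 : ℝ) ∉ uIcc (a * ρ) ρ := by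
      rw [uIcc_of_le hle]
      exact fun h0 => absurd h0.1 (not_le.2 haρ)
    have hint : IntervalIntegrable (fun s : ℝ => s⁻¹) volume (a * ρ) ρ :=
      intervalIntegral.intervalIntegrable_inv (fun x hx => fun h0 => hnot (h0 ▸ hx)) continuousOn_id
    rw [h1, ← ofReal_integral_eq_lintegral_ofReal
      ((intervalIntegrable_iff_integrableOn_Ioc_of_le hle).1 hint)
      ((ae_restrict_iff' measurableSet_Ioc).2 (Filter.Eventually.of_forall fun s hs =>
        inv_nonneg.2 (haρ.trans hs.1).le)),
      ← intervalIntegral.integral_of_le hle, integral_inv hnot]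
    congr 2
    field_simp
  calc surfaceMeasure S A * (ENNReal.ofReal κ * ENNReal.ofReal (Real.log a⁻¹))
      = ∫⁻ z in A ×ˢ Ioo (a * ρ) ρ, ENNReal.ofReal κ * (ENNReal.ofReal z.2)⁻¹
          ∂((surfaceMeasure S).prod (volume.restrict (Ioi (0 : ℝ)))) := by
        have hAI := hA.prod (measurableSet_Ioo (a := a * ρ) (b := ρ))
        have hm2 : Measurable fun z : SpaceTime n × ℝ =>
            ENNReal.ofReal κ * (ENNReal.ofReal z.2)⁻¹ := hm.comp measurable_snd
        rw [← lintegral_indicator hAI, lintegral_prod _ (hm2.indicator hAI).aemeasurable,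
          mul_comm, ← lintegral_indicator_const hA]
        refine lintegral_congr fun x => ?_
        by_cases hx : x ∈ A
        · rw [indicator_of_mem hx, ← hlog, ← lintegral_const_mul _ (by fun_prop),
            ← lintegral_indicator measurableSet_Ioo, ← lintegral_indicator measurableSet_Ioi]
          refine lintegral_congr fun s => ?_
          by_cases hs : s ∈ Ioo (a * ρ) ρ
          · simp [hx, hs.1, hs.2, haρ.trans hs.1]
          · rw [indicator_of_notMem hs, indicator_apply,
              indicator_of_notMem fun h0 => hs h0.2, ite_self]
        · simp [hx]
    _ ≤ _ := by
        -- Only the explicit minorant has to be measurable, so measurability of β is never needed.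
        refine setLIntegral_mono' (hA.prod measurableSet_Ioo) fun z hz => ?_
        gcongr
        exact h _ hz.1 _ hz.2

/-- The Carleson packing condition yields a surface ball of comparable size with small `β`. -/
theorem exists_betaNumber_sq_lt {S : Set (SpaceTime n)} {M M' κ a r : ℝ} (hM : 1 ≤ M)
    (hUR : IsParabolicUR S M M') {p : SpaceTime n} (hp : p ∈ S)
    (hpt : p ∈ timeSlab S) (hr : 0 < r) (hrS : ENNReal.ofReal r < ediam S) (hκ : 0 < κ)
    (ha : 0 < a) (ha1 : a < 1) (hlog : M * M' < κ * Real.log a⁻¹) :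
    ∃ q ∈ S, q ∈ timeSlab S ∧ q ∈ parabolicCube p r ∧ ∃ s ∈ Ioo (a * r) r,
      betaNumber S q s ^ 2 < ENNReal.ofReal κ := by
  by_contra! hcon
  obtain ⟨⟨hS, hADR⟩, hC⟩ := hUR
  have hrn : 0 < r ^ (n + 1) := by positivity
  have hM0 : 0 < M := by linarith
  have h1 := mul_log_le_betaMeasure S (surfaceCube S p r ∩ timeSlab S)
    ((hS.measurableSet.inter (isOpen_parabolicCube p r).measurableSet).inter
      (isOpen_timeSlab S).measurableSet) ha ha1 hr
    (fun q hq s hs => hcon q hq.1.1 hq.2 hq.1.2 s hs)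
  rw [surfaceMeasure_inter_timeSlab S (surfaceCube S p r) inter_subset_left] at h1
  have h2 := (h1.trans (measure_mono (prod_mono_left inter_subset_left))).trans (hC p hp r hr)
  have h3 := (mul_le_mul_left (hADR p hp hpt r hr hrS).1 _).trans h2
  rw [← ENNReal.ofReal_mul hκ.le, ← ENNReal.ofReal_mul (by positivity)] at h3
  have hl : 0 < Real.log a⁻¹ := Real.log_pos (by rw [one_lt_inv₀ ha]; exact ha1)
  have hpos : 0 < M⁻¹ * r ^ (n + 1) * (κ * Real.log a⁻¹) := by positivity
  -- Positivity of the left side rules out truncation by `ENNReal.ofReal`.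
  have h4 := (ENNReal.ofReal_le_ofReal_iff' .. |>.1 h3).resolve_right (not_le.2 hpos)
  have h5 : M⁻¹ * (κ * Real.log a⁻¹) ≤ M' := by
    refine le_of_mul_le_mul_right ?_ hrn
    linarith
  rw [inv_mul_le_iff₀ hM0] at h5
  linarith

/-! ### From small β to uniform flatness. -/

/-- A plane containing a line parallel to the time axis lies in a vertical hyperplane. -/
theorem IsTimePlane.exists_normal {P : AffineSubspace ℝ (SpaceTime n)} (hP : IsTimePlane P) :
    ∃ (ν X : EuclideanSpace ℝ (Fin n)), ‖ν‖ = 1 ∧ ∀ q ∈ P, inner ℝ ν (q.space - X) = 0 := by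
  obtain ⟨hfin, X, hX⟩ := hP
  have htime (t : ℝ) : SpaceTime.mk (0 : EuclideanSpace ℝ (Fin n)) t ∈ P.direction := by
    have h := AffineSubspace.vsub_mem_direction (hX t) (hX 0)
    have e : (SpaceTime.mk X t -ᵥ SpaceTime.mk X 0 : SpaceTime n) = SpaceTime.mk 0 t :=
      Prod.ext (sub_self X) (sub_zero t)
    rwa [e] at h
  let ι : EuclideanSpace ℝ (Fin n) →ₗ[ℝ] SpaceTime n :=
    LinearMap.inl ℝ (EuclideanSpace ℝ (Fin n)) ℝ
  -- The direction of P contains the time axis, so it is V × ℝ; its dimension n forces V to be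
  -- proper, and ν is taken orthogonal to V.
  set V : Submodule ℝ (EuclideanSpace ℝ (Fin n)) := P.direction.comap ι
  have hmem (w : SpaceTime n) (hw : w ∈ P.direction) : w.space ∈ V := by
    have h := P.direction.sub_mem hw (htime w.time)
    have e : w - SpaceTime.mk 0 w.time = ι w.space :=
      Prod.ext (sub_zero w.space) (sub_self w.time)
    rwa [e] at h
  have hV : V ≠ ⊤ := by
    intro htop
    have h : P.direction = ⊤ := by
      refine Submodule.eq_top_iff'.2 fun w => ?_
      have hw : w.space ∈ V := htop ▸ Submodule.mem_top
      have h := P.direction.add_mem (show ι w.space ∈ P.direction from hw) (htime w.time)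
      have e : ι w.space + SpaceTime.mk 0 w.time = w :=
        Prod.ext (add_zero w.space) (zero_add w.time)
      rwa [e] at h
    rw [h, finrank_top] at hfin
    have h2 : Module.finrank ℝ (EuclideanSpace ℝ (Fin n) × ℝ) = n + 1 := by
      rw [Module.finrank_prod, finrank_euclideanSpace_fin, Module.finrank_self]
    exact absurd (h2.symm.trans hfin) (by omega)
  obtain ⟨v, hv, hv0⟩ := (Submodule.ne_bot_iff _).1 (mt Submodule.orthogonal_eq_bot_iff.1 hV)
  refine ⟨‖v‖⁻¹ • v, X, ?_, fun q hq => ?_⟩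
  · rw [norm_smul, norm_inv, norm_norm, inv_mul_cancel₀ (norm_ne_zero_iff.2 hv0)]
  · have h : q.space - X ∈ V := hmem _ (AffineSubspace.vsub_mem_direction hq (hX 0))
    rw [real_inner_smul_left, Submodule.inner_left_of_mem_orthogonal (K := V) h hv, mul_zero]

theorem exists_timePlane_of_betaNumber_sq_lt {S : Set (SpaceTime n)} {q : SpaceTime n} {s : ℝ}
    {κ : ℝ≥0∞} (h : betaNumber S q s ^ 2 < κ) :
    ∃ P : AffineSubspace ℝ (SpaceTime n), IsTimePlane P ∧ (ENNReal.ofReal (s ^ (n + 1)))⁻¹ *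
      ∫⁻ z in surfaceCube S q s, (infEDist z (P : Set (SpaceTime n)) / ENNReal.ofReal s) ^ 2
        ∂(surfaceMeasure S) < κ := by
  by_contra! hcon
  have h1 : κ ^ (1 / 2 : ℝ) ≤ betaNumber S q s :=
    le_iInf₂ fun P hP => ENNReal.rpow_le_rpow (hcon P hP) (by norm_num)
  have h2 : (κ ^ (1 / 2 : ℝ)) ^ 2 = κ := by
    rw [← ENNReal.rpow_natCast, ← ENNReal.rpow_mul]
    norm_num
  exact absurd h (not_lt.2 (h2 ▸ pow_le_pow_left₀ bot_le h1 2))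

/-- Where `β` is small, an Ahlfors–David regular set is uniformly close to a vertical
hyperplane. -/
theorem IsParabolicADR.exists_abs_inner_lt {S : Set (SpaceTime n)} {M ε s : ℝ} (hM : 1 ≤ M)
    (hS : IsParabolicADR S M) (hε : 0 < ε) (hε1 : ε ≤ 1) (hs : 0 < s)
    (hsS : ENNReal.ofReal s < ediam S) {q : SpaceTime n}
    (hβ : betaNumber S q s ^ 2 <
      ENNReal.ofReal ((ε / 2) ^ 2 * (M⁻¹ * (ε / (2 * (n + 1))) ^ (n + 1)))) :
    ∃ (ν X : EuclideanSpace ℝ (Fin n)), ‖ν‖ = 1 ∧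
      ∀ y ∈ S, y ∈ timeSlab S → y ∈ parabolicCube q (s / 2) →
        |inner ℝ ν (y.space - X)| < ε * s := by
  obtain ⟨P, hP, hlt⟩ := exists_timePlane_of_betaNumber_sq_lt hβ
  obtain ⟨ν, X, hν, hPX⟩ := hP.exists_normal
  refine ⟨ν, X, hν, fun y hyS hyt hyq => ?_⟩
  by_contra! hfar
  -- Points of Q_{δs}(y) are within (n+1)δs = εs/2 of y, so they all stay at distance at least εs/2
  -- from P.
  set δ : ℝ := ε / (2 * (n + 1)) with hδ
  have hδ0 : 0 < δ := by positivity
  have hδε : (n + 1) * δ = ε / 2 := by rw [hδ]; field_simp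
  have hδ1 : δ ≤ 1 / 2 := by
    have : 0 ≤ (n : ℝ) * δ := by positivity
    linarith
  have hδs : 0 < δ * s := mul_pos hδ0 hs
  have hball : surfaceCube S y (δ * s) ⊆ surfaceCube S q s :=
    inter_subset_inter_right _
      (parabolicCube_subset_parabolicCube hyq (by positivity) hδs.le (by nlinarith))
  have hmeas : MeasurableSet (surfaceCube S y (δ * s)) :=
    hS.1.measurableSet.inter (isOpen_parabolicCube _ _).measurableSet
  have habs (v : EuclideanSpace ℝ (Fin n)) : |inner ℝ ν v| ≤ ‖v‖ := by
    simpa [hν] using abs_real_inner_le_norm ν v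
  have hdist : ∀ z ∈ surfaceCube S y (δ * s),
      ENNReal.ofReal ((ε / 2) ^ 2) ≤
        (infEDist z (P : Set (SpaceTime n)) / ENNReal.ofReal s) ^ 2 := by
    intro z hz
    have hzy := dist_le_of_mem_parabolicCube hδs.le hz.2
    have h1 : ENNReal.ofReal (ε / 2 * s) ≤ infEDist z (P : Set (SpaceTime n)) := by
      refine le_infEDist.2 fun w hw => ?_
      rw [edist_dist]
      refine ENNReal.ofReal_le_ofReal ?_
      have hzw : ‖z.space - w.space‖ ≤ dist z w :=
        le_add_of_nonneg_right (Real.sqrt_nonneg _)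
      have hzy' : ‖z.space - y.space‖ ≤ dist z y :=
        le_add_of_nonneg_right (Real.sqrt_nonneg _)
      have e : inner ℝ ν (y.space - X) = inner ℝ ν (z.space - w.space) -
          inner ℝ ν (z.space - y.space) := by
        have hw0 : inner ℝ ν (w.space - X) = 0 := hPX w hw
        simp only [inner_sub_right] at hw0 ⊢
        linarith
      have h2 := abs_sub (inner ℝ ν (z.space - w.space)) (inner ℝ ν (z.space - y.space))
      rw [← e] at h2
      have := habs (z.space - w.space)
      have := habs (z.space - y.space)
      have e2 : (n + 1) * (δ * s) = ε / 2 * s := by rw [← hδε]; ring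
      linarith
    rw [ENNReal.ofReal_pow (by positivity)]
    refine pow_le_pow_left₀ bot_le ?_ 2
    rw [ENNReal.le_div_iff_mul_le (Or.inl (by simpa using hs)) (Or.inl ENNReal.ofReal_ne_top),
      ← ENNReal.ofReal_mul (by positivity)]
    exact h1
  have hδsS : ENNReal.ofReal (δ * s) < ediam S :=
    (ENNReal.ofReal_le_ofReal (by nlinarith)).trans_lt hsS
  have hσ := (hS.2 y hyS hyt (δ * s) hδs hδsS).1
  -- Chebyshev: one bad point y spoils a whole surface cube, whose mass is bounded below by ADR.
  -- After normalization this is exactly the threshold in `hβ`.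
  have hint : ENNReal.ofReal ((ε / 2) ^ 2) * ENNReal.ofReal (M⁻¹ * (δ * s) ^ (n + 1)) ≤
      ∫⁻ z in surfaceCube S q s, (infEDist z (P : Set (SpaceTime n)) / ENNReal.ofReal s) ^ 2
        ∂(surfaceMeasure S) := by
    refine le_trans ?_ (lintegral_mono_set hball)
    refine le_trans ?_ (setLIntegral_mono' hmeas hdist)
    rw [lintegral_const, Measure.restrict_apply_univ]
    gcongr
  refine absurd hlt (not_lt.2 ?_)
  have hsn : 0 < s ^ (n + 1) := by positivity
  refine le_trans ?_ (mul_le_mul_right hint _)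
  have hM0 : 0 < M := by linarith
  rw [← ENNReal.ofReal_inv_of_pos hsn, ← ENNReal.ofReal_mul (by positivity),
    ← ENNReal.ofReal_mul (by positivity)]
  refine ENNReal.ofReal_le_ofReal (le_of_eq ?_)
  rw [mul_pow δ s]
  field_simp

/-! ### Sides of a vertical hyperplane and synchronization. -/

/-- Preconnected sets avoiding `S` and meeting sets in different components can replace them. -/
theorem InDifferentComponents.of_preconnected {S A B U V A' B' : Set (SpaceTime n)}
    (h : InDifferentComponents S A B) (hU : IsPreconnected U) (hV : IsPreconnected V)
    (hUS : U ⊆ Sᶜ) (hVS : V ⊆ Sᶜ) (hAU : (A ∩ U).Nonempty) (hBV : (B ∩ V).Nonempty)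
    (hA' : A'.Nonempty) (hB' : B'.Nonempty) (hA'U : A' ⊆ U) (hB'V : B' ⊆ V) :
    InDifferentComponents S A' B' := by
  obtain ⟨-, -, a, ha, b, hb, hne, hAa, hBb⟩ := h
  obtain ⟨x, hxA, hxU⟩ := hAU
  obtain ⟨y, hyB, hyV⟩ := hBV
  refine ⟨hA', hB', a, ha, b, hb, hne, hA'U.trans ?_, hB'V.trans ?_⟩
  · rw [connectedComponentIn_eq (hAa hxA)]
    exact hU.subset_connectedComponentIn hxU hUS
  · rw [connectedComponentIn_eq (hBb hyB)]
    exact hV.subset_connectedComponentIn hyV hVS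

/-- The part of `Q_R(q)` in the time slab, at height at least `η` on the side `σ = ±1` of the
vertical hyperplane through `X` with normal `ν`. -/
def cubeSide (S : Set (SpaceTime n)) (q : SpaceTime n) (R η σ : ℝ)
    (ν X : EuclideanSpace ℝ (Fin n)) : Set (SpaceTime n) :=
  parabolicCube q R ∩ timeSlab S ∩ {z | η ≤ σ * inner ℝ ν (z.space - X)}

theorem isPreconnected_cubeSide (S : Set (SpaceTime n)) (q : SpaceTime n) (R η σ : ℝ)
    (ν X : EuclideanSpace ℝ (Fin n)) : IsPreconnected (cubeSide S q R η σ ν X) := by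
  refine (((convex_parabolicCube q R).inter (convex_timeSlab S)).inter ?_).isPreconnected
  intro x hx y hy a b ha hb hab
  simp only [mem_ofPred_eq, add_space, smul_space] at *
  have e : inner ℝ ν (a • x.space + b • y.space - X) =
      a * inner ℝ ν (x.space - X) + b * inner ℝ ν (y.space - X) := by
    rw [← real_inner_smul_right, ← real_inner_smul_right, ← inner_add_right]
    congr 1
    have : X = a • X + b • X := by rw [← add_smul, hab, one_smul]
    nth_rewrite 1 [this]
    module
  rw [e]
  have e2 : η = a * η + b * η := by rw [← add_mul, hab, one_mul]
  nlinarith [mul_le_mul_of_nonneg_left hx ha, mul_le_mul_of_nonneg_left hy hb]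

/-- A spatial cube of side `ρ` contains points far from a given hyperplane. -/
theorem exists_le_mul_inner {ν : EuclideanSpace ℝ (Fin n)} (hν : ‖ν‖ = 1)
    (X Y : EuclideanSpace ℝ (Fin n)) {ρ : ℝ} (hρ : 0 < ρ) :
    ∃ (w : EuclideanSpace ℝ (Fin n)) (σ : ℝ), (σ = 1 ∨ σ = -1) ∧
      ρ / 2 ≤ σ * inner ℝ ν (w - X) ∧ ∀ i, |w i - Y i| ≤ ρ / 2 := by
  have hν2 : inner ℝ ν ν = 1 := by rw [real_inner_self_eq_norm_sq, hν, one_pow]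
  have hνi (i : Fin n) : |ν i| ≤ 1 := hν ▸ EuclideanSpace.abs_apply_le_norm ν i
  have hi (i : Fin n) : |ρ / 2 * ν i| ≤ ρ / 2 := by
    rw [abs_mul, abs_of_pos (half_pos hρ)]
    exact mul_le_of_le_one_right (half_pos hρ).le (hνi i)
  -- Move from Y by ρ/2 along the normal, away from the hyperplane.
  rcases le_total 0 (inner ℝ ν (Y - X)) with h | h
  · refine ⟨Y + (ρ / 2) • ν, 1, Or.inl rfl, ?_, fun i => by simpa using hi i⟩
    rw [add_sub_right_comm, inner_add_right, real_inner_smul_right, hν2]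
    linarith
  · refine ⟨Y - (ρ / 2) • ν, -1, Or.inr rfl, ?_, fun i => by simpa using hi i⟩
    rw [sub_right_comm, inner_sub_right, real_inner_smul_right, hν2]
    linarith

/-- Only the spatial positions of the two cubes matter: the height over a vertical hyperplane does
not depend on time, so both can be recentred at the time of q. -/
theorem exists_synchronized_of_flat (hn : 1 ≤ n) {S : Set (SpaceTime n)} {q : SpaceTime n}
    (hq : q ∈ timeSlab S) {R η ρ : ℝ} (hρ : 0 < ρ) (hρR : ρ < R) (hη : 4 * η ≤ ρ)
    {ν X : EuclideanSpace ℝ (Fin n)} (hν : ‖ν‖ = 1)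
    (hflat : ∀ y ∈ S, y ∈ timeSlab S → y ∈ parabolicCube q R → |inner ℝ ν (y.space - X)| < η)
    {p₁ p₂ : SpaceTime n} (h₁ : parabolicCube p₁ ρ ⊆ parabolicCube q R)
    (h₂ : parabolicCube p₂ ρ ⊆ parabolicCube q R)
    (hdiff : InDifferentComponents S (parabolicCube p₁ ρ ∩ timeSlab S)
      (parabolicCube p₂ ρ ∩ timeSlab S)) :
    ∃ p₁' p₂' : SpaceTime n, parabolicCube p₁' (ρ / (4 * n)) ⊆ parabolicCube q R ∧
      parabolicCube p₂' (ρ / (4 * n)) ⊆ parabolicCube q R ∧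
      InDifferentComponents S (parabolicCube p₁' (ρ / (4 * n)) ∩ timeSlab S)
        (parabolicCube p₂' (ρ / (4 * n)) ∩ timeSlab S) ∧ p₁'.time = p₂'.time := by
  have hn' : (1 : ℝ) ≤ n := by exact_mod_cast hn
  -- The spatial radius is then at most nρ' = ρ/4, so a cube centred at height ρ/2 or more stays at
  -- height at least ρ/4 ≥ η.
  set ρ' : ℝ := ρ / (4 * n) with hρ'
  have hρ'0 : 0 < ρ' := by positivity
  have hnρ : n * ρ' = ρ / 4 := by rw [hρ']; field_simp
  have hρ'4 : ρ' ≤ ρ / 4 := by nlinarith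
  have avoid {σ : ℝ} (hσ : σ = 1 ∨ σ = -1) : cubeSide S q R η σ ν X ⊆ Sᶜ := by
    rintro z ⟨⟨hzq, hzt⟩, hz⟩ hzS
    have := abs_lt.1 (hflat z hzS hzt hzq)
    rcases hσ with rfl | rfl <;> simp only [mem_ofPred_eq] at hz <;> linarith
  have space {p : SpaceTime n} (h : parabolicCube p ρ ⊆ parabolicCube q R)
      {z : EuclideanSpace ℝ (Fin n)} (hz : ∀ i, |z i - p.space i| < ρ) (i : Fin n) :
      |z i - q.space i| < R :=
    (h (show SpaceTime.mk z p.time ∈ parabolicCube p ρ from ⟨hz, by simp [hρ]⟩)).1 i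
  have meets {p : SpaceTime n} (h : parabolicCube p ρ ⊆ parabolicCube q R)
      (hne : (parabolicCube p ρ ∩ timeSlab S).Nonempty) {w : EuclideanSpace ℝ (Fin n)} {σ : ℝ}
      (hw : ρ / 2 ≤ σ * inner ℝ ν (w - X)) (hwp : ∀ i, |w i - p.space i| ≤ ρ / 2) :
      (parabolicCube p ρ ∩ timeSlab S ∩ cubeSide S q R η σ ν X).Nonempty := by
    -- The time of z is used because the center p itself may lie outside the slab.
    obtain ⟨z, hz, hzt⟩ := hne
    have hm : SpaceTime.mk w z.time ∈ parabolicCube p ρ :=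
      ⟨fun i => (hwp i).trans_lt (by linarith), hz.2⟩
    have ht : SpaceTime.mk w z.time ∈ timeSlab S := mem_timeSlab_of_time_eq hzt rfl
    refine ⟨SpaceTime.mk w z.time, ⟨hm, ht⟩, ⟨h hm, ht⟩, ?_⟩
    simp only [mem_ofPred_eq, mk_space]
    linarith
  have sub {p : SpaceTime n} (h : parabolicCube p ρ ⊆ parabolicCube q R)
      {w : EuclideanSpace ℝ (Fin n)} (hwp : ∀ i, |w i - p.space i| ≤ ρ / 2) :
      parabolicCube (SpaceTime.mk w q.time) ρ' ⊆ parabolicCube q R := by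
    intro z hz
    refine ⟨space h fun i => ?_, ?_⟩
    · have := abs_sub_le (z.space i) (w i) (p.space i)
      have := hwp i
      have := hz.1 i
      simp only [mk_space] at this
      linarith
    · have := hz.2
      simp only [mk_time] at this
      exact this.trans (pow_lt_pow_left₀ (by linarith) hρ'0.le two_ne_zero)
  have side {w : EuclideanSpace ℝ (Fin n)} {σ : ℝ} (hσ : σ = 1 ∨ σ = -1)
      (hsub : parabolicCube (SpaceTime.mk w q.time) ρ' ⊆ parabolicCube q R)
      (hw : ρ / 2 ≤ σ * inner ℝ ν (w - X)) :
      parabolicCube (SpaceTime.mk w q.time) ρ' ∩ timeSlab S ⊆ cubeSide S q R η σ ν X := by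
    rintro z ⟨hz, hzt⟩
    refine ⟨⟨hsub hz, hzt⟩, ?_⟩
    have h1 : ‖z.space - w‖ ≤ n * ρ' :=
      EuclideanSpace.norm_le_card_mul _ hρ'0.le fun i => by simpa using (hz.1 i).le
    have h2 : |inner ℝ ν (z.space - w)| ≤ ‖z.space - w‖ := by
      simpa [hν] using abs_real_inner_le_norm ν (z.space - w)
    have h3 := abs_le.1 (h2.trans h1)
    have e : inner ℝ ν (z.space - X) = inner ℝ ν (z.space - w) + inner ℝ ν (w - X) := by
      rw [← inner_add_right, sub_add_sub_cancel]
    simp only [mem_ofPred_eq]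
    rw [e]
    rcases hσ with rfl | rfl <;> linarith
  have nonempty (w : EuclideanSpace ℝ (Fin n)) :
      (parabolicCube (SpaceTime.mk w q.time) ρ' ∩ timeSlab S).Nonempty :=
    ⟨_, mem_parabolicCube_self _ hρ'0, mem_timeSlab_of_time_eq hq rfl⟩
  -- The signs σ₁ and σ₂ need not be compared: each new cube inherits the component of its own old
  -- cube.
  obtain ⟨w₁, σ₁, hσ₁, hw₁, hwp₁⟩ := exists_le_mul_inner hν X p₁.space hρ
  obtain ⟨w₂, σ₂, hσ₂, hw₂, hwp₂⟩ := exists_le_mul_inner hν X p₂.space hρ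
  exact ⟨SpaceTime.mk w₁ q.time, SpaceTime.mk w₂ q.time, sub h₁ hwp₁, sub h₂ hwp₂,
    hdiff.of_preconnected (isPreconnected_cubeSide _ _ _ _ _ _ _)
      (isPreconnected_cubeSide _ _ _ _ _ _ _)
      (avoid hσ₁) (avoid hσ₂) (meets h₁ hdiff.1 hw₁ hwp₁) (meets h₂ hdiff.2.1 hw₂ hwp₂)
      (nonempty w₁) (nonempty w₂) (side hσ₁ (sub h₁ hwp₁) hw₁) (side hσ₂ (sub h₂ hwp₂) hw₂), rfl⟩

end

/-! ### Choice of constants and conclusion. -/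

theorem mainTheorem4 (n : ℕ) (hn : 1 ≤ n) (M γ₀ M' : ℝ) (hM : 1 ≤ M) (hγ₀ : γ₀ ∈ Set.Ioo (0 : ℝ) 1)
    (hM' : 0 ≤ M') :
    ∃ γ₁ ∈ Set.Ioo (0 : ℝ) 1, ∀ S : Set (SpaceTime n),
      IsClosed S → IsParabolicADR S M → CorkscrewCondition S γ₀ → IsParabolicUR S M M' →
        WeakSynchronizedTwoCubeCondition S γ₁ := by
  obtain ⟨hγ, hγ1⟩ := hγ₀
  have hn' : (1 : ℝ) ≤ n := by exact_mod_cast hn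
  have hM0 : 0 < M := by linarith
  -- Corkscrews at scale s/2 have ρ ≥ γ₀s/2 = 4εs, as the flat case requires.
  set ε : ℝ := γ₀ / 8 with hε
  have hε0 : 0 < ε := by positivity
  set κ : ℝ := (ε / 2) ^ 2 * (M⁻¹ * (ε / (2 * (n + 1))) ^ (n + 1))
  have hκ : 0 < κ := by positivity
  -- Makes κ log(1/a) equal to MM' + 1, just beyond what packing allows.
  set a : ℝ := Real.exp (-((M * M' + 1) / κ)) with ha
  have ha0 : 0 < a := Real.exp_pos _
  have ha1 : a < 1 := Real.exp_lt_one_iff.2 (neg_lt_zero.2 (by positivity))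
  have hlog : M * M' < κ * Real.log a⁻¹ := by
    rw [Real.log_inv, ha, Real.log_exp, neg_neg, mul_div_cancel₀ _ hκ.ne']
    linarith
  -- The final radius is ρ/(4n) ≥ γ₀s/(8n), and s > ar/2.
  refine ⟨γ₀ * a / (16 * n), ⟨by positivity, ?_⟩, ?_⟩
  · rw [div_lt_one (by positivity)]
    nlinarith
  intro S _ hADR hcork hUR p hp hpt r hr hrS
  have hr2 : ENNReal.ofReal (r / 2) < ediam S :=
    (ENNReal.ofReal_le_ofReal (by linarith)).trans_lt hrS
  -- Working at scale r/2 leaves room for Q_{s/2}(q) inside Q_r(p).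
  obtain ⟨q, hqS, hqt, hqp, s, ⟨has, hsr⟩, hβ⟩ :=
    exists_betaNumber_sq_lt hM hUR hp hpt (half_pos hr) hr2 hκ ha0 ha1 hlog
  have hs : 0 < s := lt_trans (by positivity) has
  have hsS : ENNReal.ofReal s < ediam S := (ENNReal.ofReal_le_ofReal hsr.le).trans_lt hr2
  obtain ⟨ν, X, hν, hflat⟩ := hADR.exists_abs_inner_lt hM hε0 (by linarith) hs hsS hβ
  obtain ⟨p₁, p₂, ρ, hγρ, hρs, h₁, h₂, hdiff⟩ := hcork q hqS hqt (s / 2) (half_pos hs)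
    ((ENNReal.ofReal_le_ofReal (by linarith)).trans_lt hsS)
  have hρ : 0 < ρ := lt_of_lt_of_le (by positivity) hγρ
  obtain ⟨p₁', p₂', h₁', h₂', hdiff', htime⟩ := exists_synchronized_of_flat hn hqt hρ hρs
    (show 4 * (ε * s) ≤ ρ by rw [hε]; linarith) hν hflat h₁ h₂ hdiff
  have hsub : parabolicCube q (s / 2) ⊆ parabolicCube p r :=
    parabolicCube_subset_parabolicCube hqp (half_pos hr).le (half_pos hs).le (by linarith)
  refine ⟨p₁', p₂', ρ / (4 * n), ?_, ?_, h₁'.trans hsub, h₂'.trans hsub, hdiff', htime⟩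
  · have e : γ₀ * a / (16 * n) * r = γ₀ * (a * (r / 2)) / 2 / (4 * n) := by
      field_simp
      norm_num
    rw [e]
    refine div_le_div_of_nonneg_right ?_ (by positivity)
    nlinarith
  · rw [div_lt_iff₀ (by positivity)]
    nlinarith
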